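/- Let $G$ be a (finite-dimensional, real) Lie group, with its real analytic structure, with identity $e$ and Lie algebra $\mathfrak g$, and let $(\pi,V)$ be a unitary representation of $G$, i.e. a strongly continuous homomorphism from $G$ to the unitary group of a complex Hilbert space $V$ with inner product $(\cdot,\cdot)$. Let $\mathcal B^1(V)$ be the space of trace class operators on $V$. For a continuous function $f$ on $G$, let $\operatorname{WF}_e(f)\subset i\mathfrak g^*$ and $\operatorname{SS}_e(f)\subset i\mathfrak g^*$ be the fibres over $e$ of the wave front set and of the singular spectrum (analytic wave front set) of $f$. They are computed in a real analytic chart at $e$, with values in $W=\mathbb R^n$, as follows. Write $\mathcal F[v](\xi)=(2\pi)^{-n}\int_W v(y)e^{-\langle y,\xi\rangle}\,dy$ for $\xi\in iW^*$, and let $u$ be a continuous function on an open set $X\subset W$ and $x\in X$. The zero covector is always in $\operatorname{WF}_x(u)$ and in $\operatorname{SS}_x(u)$. For $0\neq\xi\in iW^*$: * $\xi\notin\operatorname{WF}_x(u)$ iff there are an open cone $\mathcal C\ni\xi$ in $iW^*$ and $\varphi\in C_c^\infty(X)$ with $\varphi(x)\ne0$ such that for every $N$ the function $|\eta|^N|\mathcal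 F[\varphi u](\eta)|$ is bounded on $\mathcal C$; * $\xi\notin\operatorname{SS}_x(u)$ iff for any $\varphi\in C_c^\infty(X)$ that is real analytic and nonzero near $x$ there are an open set $\Omega\ni\xi$ in $iW^*$ and $\epsilon,C>0$ with $\left|\mathcal F\left[e^{-t|x-\cdot|^2}\varphi u\right](t\eta)\right|\le Ce^{-\epsilon t}$ for all $t>0$ and $\eta\in\Omega$. Define $$\operatorname{WF}(\pi)=\overline{\bigcup_{u,v\in V}\operatorname{WF}_e\big((\pi(g)u,v)\big)},\qquad \operatorname{SS}(\pi)=\overline{\bigcup_{u,v\in V}\operatorname{SS}_e\big((\pi(g)u,v)\big)},$$ $$\widetilde{\operatorname{WF}}(\pi)=\overline{\bigcup_{T\in\mathcal B^1(V)}\operatorname{WF}_e\big(\operatorname{Tr}(\pi(g)T)\big)},\qquad \widetilde{\operatorname{SS}}(\pi)=\overline{\bigcup_{T\in\mathcal B^1(V)}\operatorname{SS}_e\big(\operatorname{Tr}(\pi(g)T)\big)}.$$ Let $\operatorname{WF}^0(\pi)\subset\mathfrak g^*$ be Howe's wave front set: the closure of the union over $T\in\mathcal B^1(V)$ of the classical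 wave front sets at $e$ of $g\mapsto\operatorname{Tr}(\pi(g)T)$, defined as above but with real covectors $\eta\in W^*$ and the integrals $\int_W\varphi(y)u(y)e^{-i\eta(y)}\,dy$, the zero covector again always being included. Then $$\operatorname{WF}(\pi)=\widetilde{\operatorname{WF}}(\pi),\qquad \operatorname{SS}(\pi)=\widetilde{\operatorname{SS}}(\pi),\qquad\text{and}\qquad \operatorname{WF}(\pi)=i\operatorname{WF}^0(\pi).$$ -/

import Mathlib

open scoped Manifold ContDiff

noncomputable section

namespace RepWF

/-! ### Imaginary covectors and the Fourier transform -/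

section Dual

variable (W : Type*) [AddCommGroup W] [Module ℝ W] [TopologicalSpace W]

/-- The real vector space `iW*`: the continuous real-linear functionals on `W` with purely
imaginary values, with the topology (and norm) of the space of continuous linear maps. -/
def ImagDual : Submodule ℝ (W →L[ℝ] ℂ) where
  carrier := {ξ | ∀ w, (ξ w).re = 0}
  add_mem' := by
    intro a b ha hb w
    simp [ha w, hb w]
  zero_mem' := by
    intro w
    simp
  smul_mem' := by
    intro c a ha w
    simp [ha w]

variable {W}

/-- Multiplication by `i`, from the real dual `W*` onto `iW*`. -/
def mulI (ξ : W →L[ℝ] ℝ) : ImagDual W :=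
  ⟨Complex.I • (Complex.ofRealCLM ∘L ξ), by
    intro w
    simp⟩

end Dual

/-- A subset of a real vector space that is stable under multiplication by positive reals. -/
def IsCone {E : Type*} [AddCommGroup E] [Module ℝ E] (C : Set E) : Prop :=
  ∀ v ∈ C, ∀ t : ℝ, 0 < t → t • v ∈ C

section Euclidean

variable {W : Type*} [NormedAddCommGroup W] [InnerProductSpace ℝ W] [FiniteDimensional ℝ W]
  [MeasurableSpace W] [BorelSpace W]

/-- The space `C_c^∞(X)` of smooth complex functions with compact support contained in `X`. -/
def IsTestFunction (X : Set W) (φ : W → ℂ) : Prop :=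
  ContDiff ℝ ∞ φ ∧ HasCompactSupport φ ∧ tsupport φ ⊆ X

/-- The Fourier transform of an integrable function `v` on `W`, as a function on `iW*`:
`ℱ[v](ξ) = (2π)^{-dim W} ∫ v(y) e^{-⟨y, ξ⟩} dy`.  It is normalised so that
`v(y) = ∫ ℱ[v](ξ) e^{⟨y, ξ⟩} dξ`. -/
def imagFourier (v : W → ℂ) (ξ : ImagDual W) : ℂ :=
  (((2 * Real.pi) ^ Module.finrank ℝ W)⁻¹ : ℝ) *
    ∫ y, v y * Complex.exp (-((ξ : W →L[ℝ] ℂ) y))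

/-- `F` is rapidly decaying in `C`: `|F(ξ)| ≤ A_N |ξ|^{-N}` on `C` for every `N`. -/
def RapidlyDecaying (F : ImagDual W → ℂ) (C : Set (ImagDual W)) : Prop :=
  ∀ N : ℕ, ∃ A : ℝ, 0 < A ∧ ∀ ξ ∈ C, ‖ξ‖ ^ N * ‖F ξ‖ ≤ A

/-- The fibre over `x` of the wave front set of the distribution on the open set `X` given by
the (continuous) function `u`.  The zero covector always belongs to it; `ξ ≠ 0` does not
belong to it iff, for some open cone `C` containing `ξ` and some `φ ∈ C_c^∞(X)` with
`φ(x) ≠ 0`, the function `ℱ[φ u]` is rapidly decaying in `C`. -/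
def wavefrontFiber (X : Set W) (u : W → ℂ) (x : W) : Set (ImagDual W) :=
  {ξ | ξ = 0 ∨ ¬ ∃ C : Set (ImagDual W), IsOpen C ∧ IsCone C ∧ ξ ∈ C ∧
    ∃ φ : W → ℂ, IsTestFunction X φ ∧ φ x ≠ 0 ∧ RapidlyDecaying (imagFourier (fun y => φ y * u y)) C}

/-- The Gaussian `𝒢_t(s) = e^{-t s²}`. -/
def gauss (t s : ℝ) : ℝ := Real.exp (-(t * s ^ 2))

/-- The fibre over `x` of the singular spectrum (analytic wave front set, in the form of Bros
and Iagolnitzer) of the distribution on the open set `X` given by the (continuous) function `u`.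
The zero covector always belongs to it; `ξ ≠ 0` does not belong to it iff, for any
`φ ∈ C_c^∞(X)` that is real analytic and nonzero near `x`, there is an open set `Ω` containing `ξ`
such that `ℱ[𝒢_t(|x - ·|) φ u](tη)` is exponentially decaying in `t > 0`, uniformly for
`η ∈ Ω`. -/
def singularFiber (X : Set W) (u : W → ℂ) (x : W) : Set (ImagDual W) :=
  {ξ | ξ = 0 ∨ ¬ ∀ φ : W → ℂ, IsTestFunction X φ → AnalyticAt ℝ φ x → φ x ≠ 0 →
    ∃ Ω : Set (ImagDual W), IsOpen Ω ∧ ξ ∈ Ω ∧ ∃ ε : ℝ, 0 < ε ∧ ∃ A : ℝ, 0 < A ∧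
      ∀ t : ℝ, 0 < t → ∀ η ∈ Ω,
        ‖imagFourier (fun y => (gauss t ‖x - y‖ : ℂ) * φ y * u y) (t • η)‖ ≤
          A * Real.exp (-(ε * t))}

/-- The fibre over `x` of the wave front set in its classical form, with real covectors:
decay of `∫ φ(y) u(y) e^{-i ξ(y)} dy` in an open cone of the real dual. -/
def realWavefrontFiber (X : Set W) (u : W → ℂ) (x : W) : Set (W →L[ℝ] ℝ) :=
  {ξ | ξ = 0 ∨ ¬ ∃ C : Set (W →L[ℝ] ℝ), IsOpen C ∧ IsCone C ∧ ξ ∈ C ∧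
    ∃ φ : W → ℂ, IsTestFunction X φ ∧ φ x ≠ 0 ∧ ∀ N : ℕ, ∃ A : ℝ, 0 < A ∧ ∀ η ∈ C,
      ‖η‖ ^ N * ‖∫ y, φ y * u y * Complex.exp (-(Complex.I * (η y : ℂ)))‖ ≤ A}

end Euclidean

/-! ### Functions on manifolds -/

section Manifold

variable {n : ℕ} {M : Type*} [TopologicalSpace M] [ChartedSpace (EuclideanSpace ℝ (Fin n)) M]

/-- The fibre over `x ∈ M` of the wave front set of a continuous function `f` on a manifold:
read in the chart `ψ` at `x`, and pulled back to `i T_x* M` by the differential of `ψ`. -/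
def WFAt (f : M → ℂ) (x : M) : Set (ImagDual (TangentSpace (𝓡 n) x)) :=
  {ξ | ∃ η ∈ wavefrontFiber (extChartAt (𝓡 n) x).target (fun y => f ((extChartAt (𝓡 n) x).symm y))
      (extChartAt (𝓡 n) x x),
    ∀ v : TangentSpace (𝓡 n) x, (ξ : TangentSpace (𝓡 n) x →L[ℝ] ℂ) v =
      (η : EuclideanSpace ℝ (Fin n) →L[ℝ] ℂ)
        (mfderiv (𝓡 n) 𝓘(ℝ, EuclideanSpace ℝ (Fin n)) (extChartAt (𝓡 n) x) x v)}

/-- The fibre over `x ∈ M` of the singular spectrum of a continuous function `f` on an analytic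
manifold: read in the chart `ψ` at `x`, and pulled back by the differential of `ψ`. -/
def SSAt (f : M → ℂ) (x : M) : Set (ImagDual (TangentSpace (𝓡 n) x)) :=
  {ξ | ∃ η ∈ singularFiber (extChartAt (𝓡 n) x).target (fun y => f ((extChartAt (𝓡 n) x).symm y))
      (extChartAt (𝓡 n) x x),
    ∀ v : TangentSpace (𝓡 n) x, (ξ : TangentSpace (𝓡 n) x →L[ℝ] ℂ) v =
      (η : EuclideanSpace ℝ (Fin n) →L[ℝ] ℂ)
        (mfderiv (𝓡 n) 𝓘(ℝ, EuclideanSpace ℝ (Fin n)) (extChartAt (𝓡 n) x) x v)}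

/-- The wave front set in its classical form at `x ∈ M`, a subset of the real `T_x* M`. -/
def realWFAt (f : M → ℂ) (x : M) : Set (TangentSpace (𝓡 n) x →L[ℝ] ℝ) :=
  {ξ | ∃ η ∈ realWavefrontFiber (extChartAt (𝓡 n) x).target
      (fun y => f ((extChartAt (𝓡 n) x).symm y)) (extChartAt (𝓡 n) x x),
    ∀ v : TangentSpace (𝓡 n) x, ξ v =
      η (mfderiv (𝓡 n) 𝓘(ℝ, EuclideanSpace ℝ (Fin n)) (extChartAt (𝓡 n) x) x v)}

end Manifold

/-! ### Trace class operators -/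

section TraceClass

variable {V : Type*} [NormedAddCommGroup V] [InnerProductSpace ℂ V] [CompleteSpace V]

/-- `T` is of trace class: `∑ ⟨|T| e, e⟩ < ∞` for some orthonormal basis of `V`
(equivalently for every one), where `|T| = (T* T)^{1/2}`. -/
def IsTraceClass (T : V →L[ℂ] V) : Prop :=
  ∃ (w : Set V) (b : HilbertBasis w ℂ V), Summable fun i => (inner ℂ (b i) (CFC.abs T (b i))).re

variable (V) in
/-- The index set of a fixed orthonormal basis of `V`. -/
def basisIndex : Set V := (exists_hilbertBasis ℂ V).choose

variable (V) in
/-- A fixed orthonormal basis of `V`. -/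
def onBasis : HilbertBasis (basisIndex V) ℂ V := (exists_hilbertBasis ℂ V).choose_spec.choose

/-- The trace `∑ ⟨T e, e⟩` of a trace class operator; it does not depend on the basis. -/
def trace (T : V →L[ℂ] V) : ℂ := ∑' i, inner ℂ (onBasis V i) (T (onBasis V i))

end TraceClass

/-! ### Unitary representations -/

section Representation

variable {n : ℕ} {G : Type*} [TopologicalSpace G] [ChartedSpace (EuclideanSpace ℝ (Fin n)) G]
  [Group G] {V : Type*} [NormedAddCommGroup V] [InnerProductSpace ℂ V] [CompleteSpace V]

/-- The matrix coefficient `g ↦ (π(g) u, v)`, linear in `u` and conjugate linear in `v`. -/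
def matrixCoeff (π : G →* unitary (V →L[ℂ] V)) (u v : V) (g : G) : ℂ :=
  inner ℂ v ((π g : V →L[ℂ] V) u)

/-- The function `g ↦ Tr(π(g) T)`. -/
def traceCoeff (π : G →* unitary (V →L[ℂ] V)) (T : V →L[ℂ] V) (g : G) : ℂ :=
  trace ((π g : V →L[ℂ] V) ∘L T)

variable (n) in
/-- The wave front set of `π`, defined by matrix coefficients; a subset of `i𝔤*`. -/
def WF (π : G →* unitary (V →L[ℂ] V)) : Set (ImagDual (GroupLieAlgebra (𝓡 n) G)) :=
  closure (⋃ (u : V) (v : V), WFAt (matrixCoeff π u v) 1)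

variable (n) in
/-- The singular spectrum of `π`, defined by matrix coefficients; a subset of `i𝔤*`. -/
def SS (π : G →* unitary (V →L[ℂ] V)) : Set (ImagDual (GroupLieAlgebra (𝓡 n) G)) :=
  closure (⋃ (u : V) (v : V), SSAt (matrixCoeff π u v) 1)

variable (n) in
/-- The wave front set of `π` defined by the functions `g ↦ Tr(π(g) T)`. -/
def traceWF (π : G →* unitary (V →L[ℂ] V)) : Set (ImagDual (GroupLieAlgebra (𝓡 n) G)) :=
  closure (⋃ (T : V →L[ℂ] V) (_ : IsTraceClass T), WFAt (traceCoeff π T) 1)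

variable (n) in
/-- The singular spectrum of `π` defined by the functions `g ↦ Tr(π(g) T)`. -/
def traceSS (π : G →* unitary (V →L[ℂ] V)) : Set (ImagDual (GroupLieAlgebra (𝓡 n) G)) :=
  closure (⋃ (T : V →L[ℂ] V) (_ : IsTraceClass T), SSAt (traceCoeff π T) 1)

variable (n) in
/-- Howe's wave front set `WF⁰(π)`, a subset of the real dual `𝔤*`. -/
def howeWF (π : G →* unitary (V →L[ℂ] V)) : Set (GroupLieAlgebra (𝓡 n) G →L[ℝ] ℝ) :=
  closure (⋃ (T : V →L[ℂ] V) (_ : IsTraceClass T), realWFAt (traceCoeff π T) 1)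

end Representation

end RepWF

end

/-! Both unions agree before closures are taken. A matrix coefficient is `Tr(π(g)T)` with `T` of
rank one (`trace_comp_rankOne`), which gives one inclusion. Conversely, a trace class `T` is a
countable sum of rank one operators with `∑ ‖u j‖ * ‖v j‖ < ∞` (`IsTraceClass.exists_hasSum_trace`),
so its coefficient is an absolutely convergent sum of matrix coefficients.

Suppose a covector lies in no fibre of a matrix coefficient. Then each pair `(u, v)` satisfies decay
estimates, with cone, cutoff and constants depending on the pair. If these choices can be restricted
to countably many, Baire's theorem and Banach-Steinhaus, applied in each variable
(`exists_uniform_norm_bound₂`), give one choice with bounds `M * ‖u‖ * ‖v‖`. Such bounds can be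
summed, so the covector is absent from the fibre of the trace coefficient too.

For the singular spectrum, the cutoff is prescribed, and neighbourhood and rate can both be taken to
be `1 / (k + 1)`. For the wave front set the cutoff varies as well; `charInt_mul_decay` allows it to
be replaced by one from a fixed shrinking sequence. The identity with Howe's set is transport along
the homeomorphism `mulIEquiv`. -/

open MeasureTheory Filter Topology

namespace RepWF

/-! ### Uniform boundedness for countable unions of conditions -/

section UniformBoundedness

variable {E F : Type*} [NormedAddCommGroup E] [NormedSpace ℂ E] [CompleteSpace E]
  [NormedAddCommGroup F] [NormedSpace ℂ F] {σ : ℂ →+* ℂ} [RingHomIsometric σ]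

/-- A Banach space that is a countable union of subspaces, each defined by countably many
boundedness conditions on families of operators, satisfies one of these sets of conditions
uniformly. -/
theorem exists_uniform_norm_bound {ι : ℕ → ℕ → Type*} (T : ∀ k N, ι k N → E →SL[σ] F)
    (h : ∀ x, ∃ k, ∀ N, ∃ M : ℝ, ∀ α, ‖T k N α x‖ ≤ M) :
    ∃ k, ∀ N, ∃ M : ℝ, ∀ α, ‖T k N α‖ ≤ M := by
  by_contra! hcon
  choose N hN using hcon
  -- For each `k` only the level `N k` at which uniformity fails is kept, so countably many closed
  -- sets cover `E` and Baire's theorem applies.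
  let A : ℕ × ℕ → Set E := fun p => {x | ∀ α, ‖T p.1 (N p.1) α x‖ ≤ p.2}
  have hclosed : ∀ p, IsClosed (A p) := fun p => by
    simp only [A, Set.ofPred_forall]
    exact isClosed_iInter fun α => isClosed_le (by fun_prop) continuous_const
  have hunion : ⋃ p, A p = Set.univ := by
    refine Set.eq_univ_of_forall fun x => ?_
    obtain ⟨k, hk⟩ := h x
    obtain ⟨M, hM⟩ := hk (N k)
    obtain ⟨m, hm⟩ := exists_nat_ge M
    exact Set.mem_iUnion.2 ⟨(k, m), fun α => (hM α).trans hm⟩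
  obtain ⟨⟨k, m⟩, x₀, hx₀⟩ := nonempty_interior_of_iUnion_of_closed hclosed hunion
  -- The points bounded at level `N k` form a subspace; having interior, it is all of `E`, and
  -- Banach-Steinhaus contradicts the choice of `N k`.
  let S : Submodule ℂ E :=
    { carrier := {x | ∃ M : ℝ, ∀ α, ‖T k (N k) α x‖ ≤ M}
      add_mem' := by
        rintro a b ⟨M, hM⟩ ⟨M', hM'⟩
        exact ⟨M + M', fun α => by
          rw [map_add]
          exact (norm_add_le _ _).trans (add_le_add (hM α) (hM' α))⟩
      zero_mem' := ⟨0, fun α => by simp⟩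
      smul_mem' := by
        rintro c x ⟨M, hM⟩
        exact ⟨‖σ c‖ * M, fun α => by
          rw [map_smulₛₗ, norm_smul]
          exact mul_le_mul_of_nonneg_left (hM α) (norm_nonneg _)⟩ }
  have hS : S = ⊤ := S.eq_top_of_nonempty_interior'
    ⟨x₀, interior_mono (fun x hx => ⟨m, hx⟩ : A (k, m) ⊆ S) hx₀⟩
  obtain ⟨M, hM⟩ := banach_steinhaus (g := T k (N k)) fun x =>
    (hS ▸ Submodule.mem_top : x ∈ S)
  obtain ⟨α, hα⟩ := hN k M
  exact absurd (hM α) (not_le.2 hα)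

/-- The version of `exists_uniform_norm_bound` for sesquilinear forms. -/
theorem exists_uniform_norm_bound₂ {ι : ℕ → ℕ → Type*}
    (B : ∀ k N, ι k N → E →L⋆[ℂ] E →L[ℂ] ℂ)
    (h : ∀ u v, ∃ k, ∀ N, ∃ M : ℝ, ∀ α, ‖B k N α v u‖ ≤ M) :
    ∃ k, ∀ N, ∃ M : ℝ, ∀ α, ‖B k N α‖ ≤ M :=
  -- The inner application fixes `v` and makes the bounds uniform in `u`; the outer one treats the
  -- conjugate linear dependence on `v`, hence the general `σ` above.
  exists_uniform_norm_bound B fun v =>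
    exists_uniform_norm_bound (fun k N α => B k N α v) fun u => h u v

end UniformBoundedness

/-! ### Compactly supported weights -/

section Weights

variable {W : Type*} [TopologicalSpace W]

/-- A continuous function with compact support contained in `X`. -/
structure IsWeight (X : Set W) (w : W → ℂ) : Prop where
  continuous : Continuous w
  hasCompactSupport : HasCompactSupport w
  tsupport_subset : tsupport w ⊆ X

theorem IsWeight.mul_continuous {X : Set W} {w a : W → ℂ} (hw : IsWeight X w)
    (ha : Continuous a) : IsWeight X fun y => a y * w y :=
  ⟨ha.mul hw.continuous, hw.hasCompactSupport.mul_left,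
    (tsupport_mul_subset_right (f := a) (g := w)).trans hw.tsupport_subset⟩

theorem IsWeight.continuous_mul {X : Set W} (hX : IsOpen X) {w f : W → ℂ} (hw : IsWeight X w)
    (hf : ContinuousOn f X) : Continuous fun y => w y * f y :=
  ContinuousOn.continuous_of_tsupport_subset (hw.continuous.continuousOn.mul hf) hX
    ((tsupport_mul_subset_left (f := w) (g := f)).trans hw.tsupport_subset)

variable [MeasurableSpace W] [BorelSpace W] {μ : Measure W}
  [IsFiniteMeasureOnCompacts μ]

theorem IsWeight.integrable [T2Space W] {X : Set W} {w : W → ℂ} (hw : IsWeight X w) :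
    Integrable w μ :=
  hw.continuous.integrable_of_hasCompactSupport hw.hasCompactSupport

theorem IsWeight.integrable_mul [T2Space W] {X : Set W} (hX : IsOpen X) {w f : W → ℂ}
    (hw : IsWeight X w) (hf : ContinuousOn f X) : Integrable (fun y => w y * f y) μ :=
  (hw.continuous_mul hX hf).integrable_of_hasCompactSupport hw.hasCompactSupport.mul_right

end Weights

/-! ### Integrated coefficients and their absolutely convergent sums -/

section Pairing

variable {W : Type*} [TopologicalSpace W] [T2Space W] [MeasurableSpace W] [BorelSpace W]
  {μ : Measure W} [IsFiniteMeasureOnCompacts μ]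
  {V : Type*} [NormedAddCommGroup V] [InnerProductSpace ℂ V] [CompleteSpace V]
  {X : Set W} {P : W → V →L[ℂ] V}

omit [CompleteSpace V] in
theorem norm_inner_apply_le {K : V →L[ℂ] V} (hK : ‖K‖ ≤ 1) (u v : V) :
    ‖inner ℂ v (K u)‖ ≤ ‖u‖ * ‖v‖ :=
  calc ‖inner ℂ v (K u)‖ ≤ ‖v‖ * ‖K u‖ := norm_inner_le_norm _ _
    _ ≤ ‖v‖ * (1 * ‖u‖) := by gcongr; exact K.le_of_opNorm_le hK u
    _ = ‖u‖ * ‖v‖ := by ring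

variable (μ) in
/-- The sesquilinear form `(v, u) ↦ ∫ w(y) ⟨v, P(y) u⟩ dy`. -/
noncomputable def pairing (hX : IsOpen X) (hP : ∀ u, ContinuousOn (fun y => P y u) X) (hP1 : ∀ y, ‖P y‖ ≤ 1)
    {w : W → ℂ} (hw : IsWeight X w) : V →L⋆[ℂ] V →L[ℂ] ℂ :=
  have hint : ∀ v u, Integrable (fun y => w y * inner ℂ v (P y u)) μ := fun v u =>
    hw.integrable_mul hX (continuousOn_const.inner (hP u))
  (LinearMap.mk₂'ₛₗ (starRingEnd ℂ) (RingHom.id ℂ)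
    (fun v u => ∫ y, w y * inner ℂ v (P y u) ∂μ)
    (fun v v' u => by
      rw [← integral_add (hint v u) (hint v' u)]
      simp only [inner_add_left, mul_add])
    (fun c v u => by
      rw [smul_eq_mul, ← integral_const_mul]
      simp only [inner_smul_left, mul_left_comm])
    (fun v u u' => by
      rw [← integral_add (hint v u) (hint v u')]
      simp only [map_add, inner_add_right, mul_add])
    (fun c v u => by
      rw [smul_eq_mul, ← integral_const_mul]
      simp only [map_smul, inner_smul_right, mul_left_comm, RingHom.id_apply])).mkContinuous₂
    (∫ y, ‖w y‖ ∂μ) fun v u => by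
      rw [LinearMap.mk₂'ₛₗ_apply, mul_assoc, ← integral_mul_const]
      refine norm_integral_le_of_norm_le (hw.integrable.norm.mul_const _) (.of_forall fun y => ?_)
      rw [norm_mul, mul_comm ‖v‖]
      exact mul_le_mul_of_nonneg_left (norm_inner_apply_le (hP1 y) u v) (norm_nonneg _)

-- Since `‖P y‖ ≤ 1`, the terms have `L¹` norms at most `(∫ ‖w‖) * ‖u j‖ * ‖v j‖`, which justifies
-- termwise integration over the countable index set; the bounds `hM` are then summed.
omit [CompleteSpace V] in
theorem norm_integral_hasSum_le {ι : Type*} [Countable ι] {u v : ι → V}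
    (huv : Summable fun j => ‖u j‖ * ‖v j‖) {f : W → ℂ} (hX : IsOpen X)
    (hP : ∀ u, ContinuousOn (fun y => P y u) X) (hP1 : ∀ y, ‖P y‖ ≤ 1)
    (hf : ∀ y, HasSum (fun j => inner ℂ (v j) (P y (u j))) (f y))
    {w : W → ℂ} (hw : IsWeight X w) {M : ℝ}
    (hM : ∀ j, ‖∫ y, w y * inner ℂ (v j) (P y (u j)) ∂μ‖ ≤ M * (‖u j‖ * ‖v j‖)) :
    ‖∫ y, w y * f y ∂μ‖ ≤ M * ∑' j, ‖u j‖ * ‖v j‖ := by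
  have hle : ∀ j y, ‖w y * inner ℂ (v j) (P y (u j))‖ ≤ ‖w y‖ * (‖u j‖ * ‖v j‖) := fun j y => by
    rw [norm_mul]
    exact mul_le_mul_of_nonneg_left (norm_inner_apply_le (hP1 y) _ _) (norm_nonneg _)
  have hint : ∀ j, Integrable (fun y => w y * inner ℂ (v j) (P y (u j))) μ := fun j =>
    hw.integrable_mul hX (continuousOn_const.inner (hP _))
  have hsum := hasSum_integral_of_summable_integral_norm hint
    (Summable.of_nonneg_of_le (fun j => integral_nonneg fun y => norm_nonneg _)
      (fun j => (integral_mono (hint j).norm (hw.integrable.norm.mul_const _) (hle j)).trans_eq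
        (integral_mul_const _ _)) (huv.mul_left (∫ y, ‖w y‖ ∂μ)))
  have hcongr : ∫ y, ∑' j, w y * inner ℂ (v j) (P y (u j)) ∂μ = ∫ y, w y * f y ∂μ :=
    integral_congr_ae (.of_forall fun y => ((hf y).mul_left (w y)).tsum_eq)
  rw [hcongr] at hsum
  rw [← hsum.tsum_eq, ← tsum_mul_left]
  exact tsum_of_norm_bounded (huv.mul_left M).hasSum hM

/-- If for all `u` and `v` the integrals `∫ w(y) ⟨v, P(y) u⟩ dy` satisfy one out of countably many
sets of bounds, then one of these sets is satisfied when `⟨v, P(y) u⟩` is replaced by any absolutely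
convergent sum of such functions. -/
theorem exists_bound_of_hasSum {ι : ℕ → ℕ → Type*} (hX : IsOpen X)
    (hP : ∀ u, ContinuousOn (fun y => P y u) X) (hP1 : ∀ y, ‖P y‖ ≤ 1)
    (w : ∀ k N, ι k N → W → ℂ) (hw : ∀ k N α, IsWeight X (w k N α))
    (h : ∀ u v, ∃ k, ∀ N, ∃ M : ℝ, ∀ α, ‖∫ y, w k N α y * inner ℂ v (P y u) ∂μ‖ ≤ M)
    {κ : Type*} [Countable κ] {u v : κ → V}
    (huv : Summable fun j => ‖u j‖ * ‖v j‖) {f : W → ℂ}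
    (hf : ∀ y, HasSum (fun j => inner ℂ (v j) (P y (u j))) (f y)) :
    ∃ k, ∀ N, ∃ M : ℝ, ∀ α, ‖∫ y, w k N α y * f y ∂μ‖ ≤ M := by
  obtain ⟨k, hk⟩ := exists_uniform_norm_bound₂
    (fun k N α => pairing μ hX hP hP1 (hw k N α)) h
  refine ⟨k, fun N => ?_⟩
  obtain ⟨M, hM⟩ := hk N
  refine ⟨_, fun α => norm_integral_hasSum_le huv hX hP hP1 hf (hw k N α) (M := M) fun j => ?_⟩
  calc _ ≤ ‖pairing μ hX hP hP1 (hw k N α)‖ * ‖v j‖ * ‖u j‖ :=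
        (pairing μ hX hP hP1 (hw k N α)).le_opNorm₂ (v j) (u j)
    _ ≤ M * ‖v j‖ * ‖u j‖ := by gcongr; exact hM α
    _ = M * (‖u j‖ * ‖v j‖) := by ring

end Pairing

/-! ### Trace class operators as sums of rank one operators -/

section TraceClassDecomposition

variable {V : Type*} [NormedAddCommGroup V] [InnerProductSpace ℂ V] [CompleteSpace V]

theorem mul_le_sq_add_sq (a b : ℝ) : a * b ≤ a ^ 2 + b ^ 2 := by
  nlinarith [sq_nonneg (a - b), sq_nonneg a, sq_nonneg b]

/-- Polar decomposition: every bounded operator factors through its absolute value. -/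
theorem exists_eq_comp_abs (T : V →L[ℂ] V) : ∃ U : V →L[ℂ] V, T = U ∘L CFC.abs T := by
  set A := CFC.abs T with hA
  have hAsa : ContinuousLinearMap.adjoint A = A :=
    (IsSelfAdjoint.of_nonneg (CFC.abs_nonneg T)).star_eq
  have hnorm : ∀ x, ‖T x‖ = ‖A x‖ := fun x => by
    have h1 : (ContinuousLinearMap.adjoint T ∘L T) x = (A ∘L A) x :=
      congrArg (fun S : V →L[ℂ] V => S x) (CFC.abs_mul_abs T).symm
    have h3 := congrArg (inner ℂ x) h1
    have h5 : inner ℂ x (A (A x)) = inner ℂ (A x) (A x) := by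
      rw [← ContinuousLinearMap.adjoint_inner_left, hAsa]
    rw [ContinuousLinearMap.comp_apply, ContinuousLinearMap.comp_apply,
      ContinuousLinearMap.adjoint_inner_right, h5] at h3
    have h4 : ‖T x‖ ^ 2 = ‖A x‖ ^ 2 := by
      rw [← inner_self_eq_norm_sq (𝕜 := ℂ), ← inner_self_eq_norm_sq (𝕜 := ℂ), h3]
    exact (sq_eq_sq₀ (norm_nonneg _) (norm_nonneg _)).1 h4
  -- By `hnorm`, `A x ↦ T x` is well defined and isometric on the range of `A`. It extends
  -- continuously to the closure `R`, and by zero to the orthogonal complement through the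
  -- projection.
  let R := (LinearMap.range (A : V →ₗ[ℂ] V)).topologicalClosure
  have hmem : ∀ x, (A : V →ₗ[ℂ] V) x ∈ R := fun x =>
    Submodule.le_topologicalClosure _ ⟨x, rfl⟩
  let e : V →ₗ[ℂ] R := (A : V →ₗ[ℂ] V).codRestrict R hmem
  have hdense : DenseRange e := by
    intro y
    rw [mem_closure_iff_seq_limit]
    obtain ⟨x, hx, hlim⟩ := mem_closure_iff_seq_limit.1
      (show (y : V) ∈ closure (LinearMap.range (A : V →ₗ[ℂ] V) : Set V) from y.2)
    choose z hz using hx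
    refine ⟨fun n => e (z n), fun n => ⟨z n, rfl⟩, tendsto_subtype_rng.2 ?_⟩
    exact hlim.congr fun n => (hz n).symm
  let U₀ : R →L[ℂ] V := (T : V →ₗ[ℂ] V).extendOfNorm e
  have hU₀ : ∀ x, U₀ (e x) = T x := fun x =>
    LinearMap.extendOfNorm_eq hdense ⟨1, fun x => by
      rw [one_mul]
      exact (hnorm x).le⟩ x
  have : CompleteSpace R := (Submodule.isClosed_topologicalClosure _).completeSpace_coe
  refine ⟨U₀ ∘L R.orthogonalProjectionOnto, ContinuousLinearMap.ext fun x => ?_⟩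
  have : R.orthogonalProjectionOnto (A x) = e x :=
    Submodule.orthogonalProjectionOnto_mem_subspace_eq_self (e x)
  rw [ContinuousLinearMap.comp_apply, ContinuousLinearMap.comp_apply, this, hU₀]

variable {ι κ : Type*}

omit [CompleteSpace V] in
theorem hasSum_norm_inner_sq (b : HilbertBasis ι ℂ V) (x : V) :
    HasSum (fun i => ‖inner ℂ (b i) x‖ ^ 2) (‖x‖ ^ 2) := by
  have h := Complex.hasSum_re (b.hasSum_inner_mul_inner x x)
  have h1 : (inner ℂ x x : ℂ).re = ‖x‖ ^ 2 := inner_self_eq_norm_sq (𝕜 := ℂ) x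
  rw [h1] at h
  convert h using 2 with i
  have h2 : (inner ℂ x (b i) * inner ℂ (b i) x : ℂ).re = ‖inner ℂ x (b i) * inner ℂ (b i) x‖ :=
    inner_mul_symm_re_eq_norm (𝕜 := ℂ) x (b i)
  rw [h2, norm_mul, norm_inner_symm x, sq]

omit [CompleteSpace V] in
theorem summable_norm_inner_sq (b : HilbertBasis ι ℂ V) (e : HilbertBasis κ ℂ V)
    {S : V →L[ℂ] V} (h : Summable fun i => ‖S (b i)‖ ^ 2) :
    Summable fun p : ι × κ => ‖inner ℂ (e p.2) (S (b p.1))‖ ^ 2 := by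
  rw [summable_prod_of_nonneg fun p => sq_nonneg _]
  exact ⟨fun i => (hasSum_norm_inner_sq e (S (b i))).summable,
    h.congr fun i => (hasSum_norm_inner_sq e (S (b i))).tsum_eq.symm⟩

/-- By Parseval both sums equal the double sum of `‖⟨e j, S (b i)⟩‖²`, taken in either order. This
passes from the basis supplied by `IsTraceClass` to the fixed basis that defines `trace`. -/
theorem summable_norm_adjoint_sq (b : HilbertBasis ι ℂ V) (e : HilbertBasis κ ℂ V)
    {S : V →L[ℂ] V} (h : Summable fun i => ‖S (b i)‖ ^ 2) :
    Summable fun j => ‖ContinuousLinearMap.adjoint S (e j)‖ ^ 2 := by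
  have h1 := (summable_norm_inner_sq b e h).prod_symm.prod
  refine h1.congr fun j => ?_
  rw [← (hasSum_norm_inner_sq b (ContinuousLinearMap.adjoint S (e j))).tsum_eq]
  refine tsum_congr fun i => ?_
  rw [ContinuousLinearMap.adjoint_inner_right, norm_inner_symm]
  rfl

omit [CompleteSpace V] in
theorem summable_norm_comp_sq {b : ι → V} {S : V →L[ℂ] V} (K : V →L[ℂ] V)
    (h : Summable fun i => ‖S (b i)‖ ^ 2) : Summable fun i => ‖(K ∘L S) (b i)‖ ^ 2 :=
  Summable.of_nonneg_of_le (fun i => sq_nonneg _)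
    (fun i => by
      rw [← mul_pow]
      exact pow_le_pow_left₀ (norm_nonneg _) (K.le_opNorm _) 2) (h.mul_left (‖K‖ ^ 2))

/-- Cyclicity of the trace for a product of two Hilbert-Schmidt operators. -/
theorem hasSum_inner_trace_comp (e : HilbertBasis ι ℂ V) {C A : V →L[ℂ] V}
    (hC : Summable fun i => ‖C (e i)‖ ^ 2) (hA : Summable fun i => ‖A (e i)‖ ^ 2) :
    HasSum (fun j => inner ℂ (ContinuousLinearMap.adjoint A (e j)) (C (e j)))
      (∑' i, inner ℂ (e i) (C (A (e i)))) := by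
  -- Absolute summability of the double series, by comparison with two Hilbert-Schmidt sums, permits
  -- summing by rows and by columns.
  have hsum : Summable fun p : ι × ι =>
      inner ℂ (e p.1) (C (e p.2)) * inner ℂ (e p.2) (A (e p.1)) := by
    have h1 := (summable_norm_inner_sq e e hC).prod_symm
    have h2 := summable_norm_inner_sq e e hA
    refine Summable.of_norm_bounded (h1.add h2) fun p => ?_
    rw [norm_mul]
    change _ ≤ ‖inner ℂ (e p.1) (C (e p.2))‖ ^ 2 + ‖inner ℂ (e p.2) (A (e p.1))‖ ^ 2
    exact mul_le_sq_add_sq _ _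
  have hrow : ∀ i, HasSum (fun j => inner ℂ (e i) (C (e j)) * inner ℂ (e j) (A (e i)))
      (inner ℂ (e i) (C (A (e i)))) := fun i => by
    simpa only [ContinuousLinearMap.adjoint_inner_left] using
      e.hasSum_inner_mul_inner (ContinuousLinearMap.adjoint C (e i)) (A (e i))
  have hcol : ∀ j, HasSum (fun i => inner ℂ (e i) (C (e j)) * inner ℂ (e j) (A (e i)))
      (inner ℂ (ContinuousLinearMap.adjoint A (e j)) (C (e j))) := fun j => by
    have := e.hasSum_inner_mul_inner (ContinuousLinearMap.adjoint A (e j)) (C (e j))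
    simpa only [ContinuousLinearMap.adjoint_inner_left, mul_comm] using this
  have h1 := hsum.hasSum.prod_fiberwise hrow
  have h2 := hsum.prod_symm.hasSum.prod_fiberwise hcol
  rw [h1.tsum_eq]
  convert h2 using 1
  exact ((Equiv.prodComm ι ι).tsum_eq
    (fun p : ι × ι => inner ℂ (e p.1) (C (e p.2)) * inner ℂ (e p.2) (A (e p.1)))).symm

theorem summable_norm_sqrt_abs_sq {b : ι → V} {T : V →L[ℂ] V}
    (h : Summable fun i => (inner ℂ (b i) (CFC.abs T (b i))).re) :
    Summable fun i => ‖CFC.sqrt (CFC.abs T) (b i)‖ ^ 2 := by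
  refine h.congr fun i => ?_
  set A := CFC.sqrt (CFC.abs T) with hA
  have hAsa : ContinuousLinearMap.adjoint A = A :=
    (IsSelfAdjoint.of_nonneg (CFC.sqrt_nonneg _)).star_eq
  have hAA : CFC.abs T = A ∘L A := (CFC.sqrt_mul_sqrt_self _ (CFC.abs_nonneg T)).symm
  rw [hAA, ContinuousLinearMap.comp_apply]
  conv_lhs => rw [← hAsa, ContinuousLinearMap.adjoint_inner_right, hAsa]
  rw [inner_self_eq_norm_sq_to_K]
  norm_cast

/-- A trace class operator is an absolutely convergent sum of operators of rank one. -/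
theorem IsTraceClass.exists_hasSum_trace {T : V →L[ℂ] V} (hT : IsTraceClass T) :
    ∃ (s : Set (basisIndex V)) (_ : Countable s) (u v : s → V),
      Summable (fun j => ‖u j‖ * ‖v j‖) ∧
      ∀ K : V →L[ℂ] V, HasSum (fun j => inner ℂ (v j) (K (u j))) (trace (K ∘L T)) := by
  obtain ⟨I, b, hb⟩ := hT
  set A := CFC.sqrt (CFC.abs T) with hA
  have hAsa : ContinuousLinearMap.adjoint A = A :=
    (IsSelfAdjoint.of_nonneg (CFC.sqrt_nonneg _)).star_eq
  have hAA : CFC.abs T = A ∘L A := (CFC.sqrt_mul_sqrt_self _ (CFC.abs_nonneg T)).symm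
  obtain ⟨U, hU⟩ := exists_eq_comp_abs T
  let e := onBasis V
  have hAe : Summable fun j => ‖A (e j)‖ ^ 2 := by
    have := summable_norm_adjoint_sq b e (summable_norm_sqrt_abs_sq hb)
    rwa [← hA, hAsa] at this
  have hBe := summable_norm_comp_sq U hAe
  have huv : Summable fun j => ‖(U ∘L A) (e j)‖ * ‖A (e j)‖ :=
    Summable.of_nonneg_of_le (fun j => by positivity)
      (fun j => mul_le_sq_add_sq _ _) (hBe.add hAe)
  -- With `T = U ∘L A ∘L A`, cyclicity gives `Tr(K T) = ∑ ⟨A e j, K (U A e j)⟩`. The basis may be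
  -- uncountable, but only countably many terms are nonzero.
  refine ⟨Function.support fun j => ‖(U ∘L A) (e j)‖ * ‖A (e j)‖,
    huv.countable_support.to_subtype, fun j => (U ∘L A) (e j), fun j => A (e j),
    huv.subtype _, fun K => ?_⟩
  have h := hasSum_inner_trace_comp e (summable_norm_comp_sq K hBe) hAe
  have htr : trace (K ∘L T) = ∑' i, inner ℂ (e i) ((K ∘L (U ∘L A)) (A (e i))) := by
    conv_lhs => rw [hU, hAA]
    rfl
  rw [hAsa, ← htr] at h
  refine (hasSum_subtype_iff_of_support_subset
    (f := fun j => inner ℂ (A (e j)) (K ((U ∘L A) (e j)))) fun j hj => ?_).2 h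
  contrapose! hj
  rw [Function.notMem_support, mul_eq_zero, norm_eq_zero, norm_eq_zero] at hj
  rw [Function.notMem_support]
  rcases hj with hj | hj <;> simp [hj]

/-- For `v ≠ 0` the absolute value is `‖u‖ / ‖v‖` times the rank one operator of `v` with itself, so
the diagonal sum is a multiple of Parseval's series for `v`. -/
theorem isTraceClass_rankOne (u v : V) : IsTraceClass (InnerProductSpace.rankOne ℂ u v) := by
  obtain ⟨I, b, -⟩ := exists_hilbertBasis ℂ V
  refine ⟨I, b, ?_⟩
  rcases eq_or_ne v 0 with rfl | hv
  · simp
  have hv' : (‖v‖ : ℂ) ≠ 0 := by exact_mod_cast norm_ne_zero_iff.2 hv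
  set R : V →L[ℂ] V := InnerProductSpace.rankOne ℂ v v with hR
  have hRpos : 0 ≤ R := (ContinuousLinearMap.nonneg_iff_isPositive _).2
    (InnerProductSpace.isPositive_rankOne_self v)
  have habs : CFC.abs (InnerProductSpace.rankOne ℂ u v : V →L[ℂ] V) = (‖u‖ / ‖v‖ : ℝ) • R := by
    refine CFC.sqrt_unique ?_ (smul_nonneg (by positivity) hRpos)
    rw [ContinuousLinearMap.star_eq_adjoint, InnerProductSpace.adjoint_rankOne]
    rw [hR, smul_mul_smul_comm, ContinuousLinearMap.mul_def, ContinuousLinearMap.mul_def,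
      InnerProductSpace.rankOne_comp_rankOne, InnerProductSpace.rankOne_comp_rankOne]
    have h1 : ∀ z : V, (inner ℂ z z : ℂ) = ((‖z‖ ^ 2 : ℝ) : ℂ) := fun z => by
      rw [inner_self_eq_norm_sq_to_K]
      norm_cast
    rw [h1, h1, Complex.coe_smul, Complex.coe_smul, smul_smul]
    congr 1
    field_simp
  rw [habs]
  refine ((hasSum_norm_inner_sq b v).summable.mul_left (‖u‖ / ‖v‖)).congr fun i => ?_
  rw [smul_apply, InnerProductSpace.rankOne_apply, ← Complex.coe_smul,
    inner_smul_right, inner_smul_right, Complex.re_ofReal_mul]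
  have h2 : (inner ℂ v (b i) * inner ℂ (b i) v : ℂ).re = ‖inner ℂ v (b i) * inner ℂ (b i) v‖ :=
    inner_mul_symm_re_eq_norm (𝕜 := ℂ) v (b i)
  rw [h2, norm_mul, norm_inner_symm v, sq]

theorem trace_comp_rankOne (K : V →L[ℂ] V) (u v : V) :
    trace (K ∘L InnerProductSpace.rankOne ℂ u v) = inner ℂ v (K u) := by
  rw [← (onBasis V).tsum_inner_mul_inner]
  refine tsum_congr fun i => ?_
  rw [ContinuousLinearMap.comp_apply, InnerProductSpace.rankOne_apply, map_smul,
    inner_smul_right]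

end TraceClassDecomposition

/-! ### Open cones and small perturbations -/

section Cones

variable {E : Type*} [NormedAddCommGroup E] [NormedSpace ℝ E]

/-- The cone generated by a ball. -/
def coneBall (ξ : E) (r : ℝ) : Set E := {η | ∃ t : ℝ, 0 < t ∧ t⁻¹ • η ∈ Metric.ball ξ r}

theorem isOpen_coneBall (ξ : E) (r : ℝ) : IsOpen (coneBall ξ r) := by
  have : coneBall ξ r = ⋃ (t : ℝ) (_ : 0 < t), (fun η => t⁻¹ • η) ⁻¹' Metric.ball ξ r := by
    ext η
    simp [coneBall]
  rw [this]
  exact isOpen_biUnion fun t _ => Metric.isOpen_ball.preimage (continuous_const_smul _)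

theorem smul_mem_coneBall (ξ : E) (r : ℝ) :
    ∀ v ∈ coneBall ξ r, ∀ t : ℝ, 0 < t → t • v ∈ coneBall ξ r := by
  rintro η ⟨t, ht, hη⟩ s hs
  refine ⟨s * t, mul_pos hs ht, ?_⟩
  rwa [smul_smul, mul_inv, mul_right_comm, inv_mul_cancel₀ hs.ne', one_mul]

theorem mem_coneBall_self {ξ : E} {r : ℝ} (hr : 0 < r) : ξ ∈ coneBall ξ r :=
  ⟨1, one_pos, by simpa using hr⟩

/-- An open cone absorbs relatively small perturbations of the vectors in a smaller cone. -/
theorem exists_coneBall_sub_mem {C : Set E} (hC : IsOpen C)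
    (hcone : ∀ v ∈ C, ∀ t : ℝ, 0 < t → t • v ∈ C) {ξ : E} (hξ : ξ ∈ C) : ∃ r, 0 < r ∧ ∃ δ : ℝ, 0 < δ ∧ δ ≤ 1 / 2 ∧ ∀ s ≤ r, ∀ η ∈ coneBall ξ s,
      ∀ ζ : E, ‖ζ‖ ≤ δ * ‖η‖ → η - ζ ∈ C := by
  obtain ⟨R, hR, hball⟩ := Metric.isOpen_iff.1 hC ξ hξ
  have hpos : 0 < ‖ξ‖ + R := by positivity
  -- After rescaling, `η` is within `R / 2` of `ξ` and has norm at most `‖ξ‖ + R`, so this `δ`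
  -- leaves `R / 2` for `ζ`. The bound `1 / 2` serves `charInt_mul_decay`, where it keeps `‖ξ - ζ‖`
  -- at least `‖ξ‖ / 2`.
  refine ⟨R / 2, by positivity, min (1 / 2) (R / 2 / (‖ξ‖ + R)), by positivity, min_le_left _ _, ?_⟩
  rintro s hs η ⟨t, ht, hη⟩ ζ hζ
  rw [mem_ball_iff_norm] at hη
  have h1 : ‖t⁻¹ • η‖ ≤ ‖ξ‖ + R := by
    have := norm_add_le (t⁻¹ • η - ξ) ξ
    rw [sub_add_cancel] at this
    linarith
  have h2 : ‖t⁻¹ • ζ‖ ≤ R / 2 := by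
    calc ‖t⁻¹ • ζ‖ = t⁻¹ * ‖ζ‖ := by rw [norm_smul, Real.norm_of_nonneg (inv_nonneg.2 ht.le)]
      _ ≤ t⁻¹ * (R / 2 / (‖ξ‖ + R) * ‖η‖) := by
        gcongr
        exact hζ.trans (mul_le_mul_of_nonneg_right (min_le_right _ _) (norm_nonneg _))
      _ = R / 2 / (‖ξ‖ + R) * ‖t⁻¹ • η‖ := by
        rw [norm_smul, Real.norm_of_nonneg (inv_nonneg.2 ht.le)]
        ring
      _ ≤ R / 2 / (‖ξ‖ + R) * (‖ξ‖ + R) := by gcongr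
      _ = R / 2 := by field_simp
  have h3 : t⁻¹ • (η - ζ) ∈ C := hball <| by
    rw [mem_ball_iff_norm]
    calc ‖t⁻¹ • (η - ζ) - ξ‖ = ‖(t⁻¹ • η - ξ) - t⁻¹ • ζ‖ := by rw [smul_sub, sub_right_comm]
      _ ≤ ‖t⁻¹ • η - ξ‖ + ‖t⁻¹ • ζ‖ := norm_sub_le _ _
      _ < R := by linarith
  have := hcone _ h3 t ht
  rwa [smul_smul, mul_inv_cancel₀ ht.ne', one_smul] at this

end Cones

/-! ### Fourier transforms on imaginary covectors and change of cutoff -/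

section Fourier

variable {W : Type*} [NormedAddCommGroup W] [InnerProductSpace ℝ W]

theorem exp_neg_imagDual_norm (ξ : ImagDual W) (y : W) :
    ‖Complex.exp (-((ξ : W →L[ℝ] ℂ) y))‖ = 1 := by
  rw [Complex.norm_exp, Complex.neg_re, ξ.2 y, neg_zero, Real.exp_zero]

theorem continuous_exp_neg_imagDual (ξ : ImagDual W) :
    Continuous fun y => Complex.exp (-((ξ : W →L[ℝ] ℂ) y)) := by
  fun_prop

/-- The imaginary covector `y ↦ -2πi⟨y, w⟩`, up to sign the frequency of the character
`e^{-2πi⟨y, w⟩}`. -/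
noncomputable def freq (w : W) : ImagDual W := mulI (-(2 * Real.pi) • innerSL ℝ w)

theorem freq_apply (w y : W) :
    (freq w : W →L[ℝ] ℂ) y = -(2 * Real.pi * inner ℝ w y * Complex.I) := by
  simp [freq, mulI]
  ring

theorem norm_freq_le (w : W) : ‖freq w‖ ≤ 2 * Real.pi * ‖w‖ := by
  change ‖(freq w : W →L[ℝ] ℂ)‖ ≤ _
  refine ContinuousLinearMap.opNorm_le_bound _ (by positivity) fun y => ?_
  have h := norm_inner_le_norm (𝕜 := ℝ) w y
  calc ‖(freq w : W →L[ℝ] ℂ) y‖ = 2 * Real.pi * ‖(inner ℝ w y : ℝ)‖ := by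
        simp [freq_apply, Real.pi_pos.le, abs_of_nonneg]
    _ ≤ 2 * Real.pi * (‖w‖ * ‖y‖) := by gcongr
    _ = 2 * Real.pi * ‖w‖ * ‖y‖ := by ring

variable [MeasurableSpace W] [BorelSpace W] [FiniteDimensional ℝ W]

/-- The Fourier transform of `imagFourier`, without its constant factor. -/
noncomputable def charInt (g : W → ℂ) (ξ : ImagDual W) : ℂ :=
  ∫ y, g y * Complex.exp (-((ξ : W →L[ℝ] ℂ) y))

theorem norm_imagFourier (g : W → ℂ) (ξ : ImagDual W) :
    ‖imagFourier g ξ‖ = ((2 * Real.pi) ^ Module.finrank ℝ W)⁻¹ * ‖charInt g ξ‖ := by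
  rw [imagFourier, norm_mul, Complex.norm_real, Real.norm_of_nonneg (by positivity), charInt]

theorem rapidlyDecaying_imagFourier_iff {g : W → ℂ} {C : Set (ImagDual W)} :
    RapidlyDecaying (imagFourier g) C ↔
      ∀ N : ℕ, ∃ A : ℝ, ∀ ξ ∈ C, ‖ξ‖ ^ N * ‖charInt g ξ‖ ≤ A := by
  have hc : 0 < (2 * Real.pi) ^ Module.finrank ℝ W := by positivity
  simp only [RapidlyDecaying, norm_imagFourier]
  refine forall_congr' fun N => ⟨?_, ?_⟩
  · rintro ⟨A, -, hA⟩
    refine ⟨(2 * Real.pi) ^ Module.finrank ℝ W * A, fun ξ hξ => ?_⟩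
    rw [← inv_mul_le_iff₀ hc, mul_left_comm]
    exact hA ξ hξ
  · rintro ⟨A, hA⟩
    refine ⟨((2 * Real.pi) ^ Module.finrank ℝ W)⁻¹ * max A 1, by positivity, fun ξ hξ => ?_⟩
    rw [mul_left_comm]
    gcongr
    exact (hA ξ hξ).trans (le_max_left _ _)

theorem norm_charInt_le (g : W → ℂ) (ξ : ImagDual W) : ‖charInt g ξ‖ ≤ ∫ y, ‖g y‖ := by
  refine (norm_integral_le_integral_norm _).trans_eq ?_
  simp only [norm_mul, exp_neg_imagDual_norm, mul_one]

theorem integrable_mul_exp {g : W → ℂ} (hg : Integrable g) (ξ : ImagDual W) :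
    Integrable fun y => g y * Complex.exp (-((ξ : W →L[ℝ] ℂ) y)) :=
  hg.mul_bdd (c := 1) (continuous_exp_neg_imagDual ξ).aestronglyMeasurable
    (.of_forall fun y => (exp_neg_imagDual_norm ξ y).le)

open FourierTransform in
/-- The Fourier transform of a product is the convolution of the Fourier transforms. -/
theorem charInt_fourier_mul {g : W → ℂ} (hg : Integrable g) (Φ : SchwartzMap W ℂ)
    (ξ : ImagDual W) :
    charInt (fun y => 𝓕 Φ y * g y) ξ = ∫ w, Φ w * charInt g (ξ - freq w) := by
  -- The Fourier transform is moved from `Φ` to `g` times the character of `ξ`, where it becomes a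
  -- shift of `ξ` by `freq w`.
  have h := VectorFourier.integral_fourierIntegral_smul_eq_flip (μ := volume) (ν := volume)
    (L := innerₗ W) Real.continuous_fourierChar continuous_inner Φ.integrable
    (integrable_mul_exp hg ξ)
  have h1 : ∀ w, VectorFourier.fourierIntegral Real.fourierChar volume (innerₗ W).flip
      (fun y => g y * Complex.exp (-((ξ : W →L[ℝ] ℂ) y))) w = charInt g (ξ - freq w) := fun w => by
    refine integral_congr_ae (.of_forall fun y => ?_)
    simp only [Circle.smul_def, Real.fourierChar_apply, LinearMap.flip_apply, innerₗ_apply_apply,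
      Submodule.coe_sub, sub_apply, freq_apply, smul_eq_mul]
    rw [mul_left_comm, ← Complex.exp_add]
    congr 2
    push_cast
    ring
  simp only [h1, smul_eq_mul] at h
  rw [← h, charInt]
  refine integral_congr_ae (.of_forall fun y => ?_)
  simp only [mul_assoc, SchwartzMap.fourier_coe]
  rfl

/-- Multiplication by a test function preserves rapid decay of the Fourier transform, in slightly
smaller cones. -/
theorem charInt_mul_decay {g ψ : W → ℂ} (hg : Integrable g) (hψ : ContDiff ℝ ∞ ψ)
    (hψc : HasCompactSupport ψ) {C Γ : Set (ImagDual W)} {δ : ℝ} (hδ : 0 < δ) (hδ' : δ ≤ 1 / 2)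
    (hΓ : ∀ ξ ∈ Γ, ∀ ζ, ‖ζ‖ ≤ δ * ‖ξ‖ → ξ - ζ ∈ C)
    (hC : ∀ N : ℕ, ∃ A : ℝ, ∀ ξ ∈ C, ‖ξ‖ ^ N * ‖charInt g ξ‖ ≤ A) (N : ℕ) :
    ∃ A : ℝ, ∀ ξ ∈ Γ, ‖ξ‖ ^ N * ‖charInt (fun y => ψ y * g y) ξ‖ ≤ A := by
  obtain ⟨A, hA⟩ := hC N
  let Ψ : SchwartzMap W ℂ := hψc.toSchwartzMap hψ
  let Φ : SchwartzMap W ℂ := FourierTransform.fourierInv Ψ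
  have hΦ : ∀ y, (FourierTransform.fourier Φ : SchwartzMap W ℂ) y = ψ y := fun y => by
    rw [FourierTransform.fourier_fourierInv_eq]
    rfl
  set I := ∫ y, ‖g y‖ with hI
  have hI0 : 0 ≤ I := integral_nonneg fun y => norm_nonneg _
  -- If `freq w` is small relative to `ξ`, the shifted covector stays in `C` and decay there
  -- applies. Otherwise `‖ξ‖` is at most a multiple of `‖w‖`, and the Schwartz decay of `Φ` absorbs
  -- the resulting power.
  have hbound : ∀ ξ ∈ Γ, ∀ w, ‖ξ‖ ^ N * ‖charInt g (ξ - freq w)‖ ≤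
      2 ^ N * max A 0 + (2 * Real.pi / δ) ^ N * I * ‖w‖ ^ N := fun ξ hξ w => by
    rcases le_total ‖freq w‖ (δ * ‖ξ‖) with h | h
    · have h1 : ‖ξ‖ ≤ 2 * ‖ξ - freq w‖ := by
        have := norm_sub_norm_le ξ (freq w)
        nlinarith [norm_nonneg ξ]
      calc ‖ξ‖ ^ N * ‖charInt g (ξ - freq w)‖
          ≤ (2 * ‖ξ - freq w‖) ^ N * ‖charInt g (ξ - freq w)‖ := by gcongr
        _ = 2 ^ N * (‖ξ - freq w‖ ^ N * ‖charInt g (ξ - freq w)‖) := by ring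
        _ ≤ 2 ^ N * max A 0 := by
          gcongr
          exact (hA _ (hΓ ξ hξ _ h)).trans (le_max_left _ _)
        _ ≤ _ := le_add_of_nonneg_right (by positivity)
    · have h1 : ‖ξ‖ ≤ 2 * Real.pi / δ * ‖w‖ := by
        rw [div_mul_eq_mul_div, le_div_iff₀ hδ, mul_comm]
        exact h.trans (norm_freq_le w)
      calc ‖ξ‖ ^ N * ‖charInt g (ξ - freq w)‖
          ≤ (2 * Real.pi / δ * ‖w‖) ^ N * I := by
            gcongr
            exact norm_charInt_le _ _
        _ = (2 * Real.pi / δ) ^ N * I * ‖w‖ ^ N := by ring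
        _ ≤ _ := le_add_of_nonneg_left (by positivity)
  have hint : Integrable fun w =>
      2 ^ N * max A 0 * ‖Φ w‖ + (2 * Real.pi / δ) ^ N * I * (‖w‖ ^ N * ‖Φ w‖) :=
    (Φ.integrable.norm.const_mul _).add ((Φ.integrable_pow_mul volume N).const_mul _)
  refine ⟨∫ w, (2 ^ N * max A 0 * ‖Φ w‖ + (2 * Real.pi / δ) ^ N * I * (‖w‖ ^ N * ‖Φ w‖)),
    fun ξ hξ => ?_⟩
  have heq := charInt_fourier_mul hg Φ ξ
  simp only [hΦ] at heq
  have hnorm : ‖ξ‖ ^ N = ‖((‖ξ‖ ^ N : ℝ) : ℂ)‖ := by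
    rw [Complex.norm_real, Real.norm_of_nonneg (by positivity)]
  rw [heq, hnorm, ← norm_mul, ← integral_const_mul]
  refine norm_integral_le_of_norm_le hint (.of_forall fun w => ?_)
  rw [norm_mul, norm_mul, ← hnorm]
  calc ‖ξ‖ ^ N * (‖Φ w‖ * ‖charInt g (ξ - freq w)‖)
      = ‖Φ w‖ * (‖ξ‖ ^ N * ‖charInt g (ξ - freq w)‖) := by ring
    _ ≤ ‖Φ w‖ * (2 ^ N * max A 0 + (2 * Real.pi / δ) ^ N * I * ‖w‖ ^ N) := by
      gcongr
      exact hbound ξ hξ w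
    _ = _ := by ring

omit [MeasurableSpace W] [BorelSpace W] [FiniteDimensional ℝ W] in
theorem IsTestFunction.isWeight {X : Set W} {φ : W → ℂ} (h : IsTestFunction X φ) :
    IsWeight X φ :=
  ⟨h.1.continuous, h.2.1, h.2.2⟩

omit [MeasurableSpace W] [BorelSpace W] [FiniteDimensional ℝ W] in
/-- A test function can be divided by a function which is smooth and has no zeros on its support. -/
theorem IsTestFunction.div {X : Set W} {φ χ : W → ℂ} (hχ : IsTestFunction X χ)
    (hφ : ContDiff ℝ ∞ φ) (h0 : ∀ y ∈ tsupport χ, φ y ≠ 0) :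
    ContDiff ℝ ∞ (fun y => χ y / φ y) ∧ HasCompactSupport (fun y => χ y / φ y) := by
  constructor
  · refine contDiff_iff_contDiffAt.2 fun y => ?_
    by_cases hy : y ∈ tsupport χ
    · simp only [div_eq_mul_inv]
      exact hχ.1.contDiffAt.mul (hφ.contDiffAt.inv (h0 y hy))
    · refine (contDiffAt_const (c := (0 : ℂ))).congr_of_eventuallyEq ?_
      filter_upwards [notMem_tsupport_iff_eventuallyEq.1 hy] with z hz
      simp [hz]
  · simp only [div_eq_mul_inv]
    exact hχ.2.1.mul_right

/-- Rapid decay in the complement of the wave front set can be tested on any sequence of test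
functions with supports shrinking to the base point. -/
theorem exists_charInt_decay_of_notMem {X : Set W} (hX : IsOpen X) {x : W} {f : W → ℂ}
    (hf : ContinuousOn f X) {ρ : ℝ} (hρ : 0 < ρ) {χ : ℕ → W → ℂ}
    (hχ : ∀ k, IsTestFunction X (χ k))
    (hχsupp : ∀ k : ℕ, tsupport (χ k) ⊆ Metric.closedBall x (ρ / (k + 1))) {ξ : ImagDual W}
    (hξ : ξ ∉ wavefrontFiber X f x) : ∃ k : ℕ, ∀ N : ℕ, ∃ A : ℝ,
      ∀ η ∈ coneBall ξ (1 / (k + 1) : ℝ), ‖η‖ ^ N * ‖charInt (fun y => χ k y * f y) η‖ ≤ A := by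
  simp only [wavefrontFiber, Set.mem_ofPred_eq, not_or, not_not] at hξ
  obtain ⟨-, C, hCo, hCc, hξC, φ, hφ, hφ0, hdec⟩ := hξ
  rw [rapidlyDecaying_imagFourier_iff] at hdec
  obtain ⟨r, hr, δ, hδ, hδ', hsub⟩ := exists_coneBall_sub_mem (E := ImagDual W) hCo
    (by
      intro v hv t ht
      have := hCc v hv t ht
      exact this) hξC
  have hev : {y | φ y ≠ 0} ∈ 𝓝 x := hφ.1.continuous.continuousAt.eventually_ne hφ0
  obtain ⟨ε, hε, hne⟩ := Metric.nhds_basis_closedBall.mem_iff.1 hev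
  -- One `k` makes the cone small enough for `hsub` and the support of `χ k` small enough that `φ`
  -- has no zeros on it; then `χ k * f = (χ k / φ) * (φ * f)`.
  obtain ⟨k, hkr⟩ := exists_nat_one_div_lt (lt_min hr (div_pos hε hρ))
  have hkε : ρ / (k + 1) ≤ ε := by
    have := (hkr.trans_le (min_le_right _ _)).le
    rw [le_div_iff₀ hρ] at this
    calc ρ / (k + 1) = 1 / (k + 1) * ρ := by ring
      _ ≤ ε := this
  have h0 : ∀ y ∈ tsupport (χ k), φ y ≠ 0 := fun y hy =>
    hne (Metric.closedBall_subset_closedBall hkε (hχsupp k hy))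
  obtain ⟨hψ, hψc⟩ := (hχ k).div hφ.1 h0
  have heq : (fun y => χ k y / φ y * (φ y * f y)) = fun y => χ k y * f y := by
    ext y
    by_cases hy : y ∈ tsupport (χ k)
    · rw [← mul_assoc, div_mul_cancel₀ _ (h0 y hy)]
    · simp [image_eq_zero_of_notMem_tsupport hy]
  have hΓ := hsub _ (hkr.trans_le (min_le_left _ _)).le
  refine ⟨k, fun N => ?_⟩
  rw [← heq]
  exact charInt_mul_decay (hφ.isWeight.integrable_mul hX hf) hψ hψc hδ hδ' hΓ hdec N

/-! ### Wave front sets and singular spectra of sums of coefficients -/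

variable {V : Type*} [NormedAddCommGroup V] [InnerProductSpace ℂ V] [CompleteSpace V]

/-- Wave front sets of absolutely convergent sums of coefficients `⟨v, P(y) u⟩`. -/
theorem exists_mem_wavefrontFiber_of_hasSum {X : Set W} {x : W} (hx : x ∈ X) {P : W → V →L[ℂ] V}
    (hX : IsOpen X) (hP : ∀ u, ContinuousOn (fun y => P y u) X) (hP1 : ∀ y, ‖P y‖ ≤ 1)
    {κ : Type*} [Countable κ] {u v : κ → V} (huv : Summable fun j => ‖u j‖ * ‖v j‖) {f : W → ℂ}
    (hf : ∀ y, HasSum (fun j => inner ℂ (v j) (P y (u j))) (f y)) {ξ : ImagDual W}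
    (hξ : ξ ∈ wavefrontFiber X f x) :
    ∃ a b : V, ξ ∈ wavefrontFiber X (fun y => inner ℂ b (P y a)) x := by
  rcases hξ with rfl | hξ
  · exact ⟨0, 0, Or.inl rfl⟩
  by_contra! hcon
  refine hξ ?_
  obtain ⟨ρ, hρ, hball⟩ := Metric.nhds_basis_closedBall.mem_iff.1 (hX.mem_nhds hx)
  have hk : ∀ k : ℕ, 0 < ρ / (k + 1) := fun k => by positivity
  let bump : ℕ → ContDiffBump x := fun k => ⟨ρ / (k + 1) / 2, ρ / (k + 1), half_pos (hk k),
    half_lt_self (hk k)⟩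
  let χ : ℕ → W → ℂ := fun k y => (bump k y : ℂ)
  have hχsupp : ∀ k, tsupport (χ k) = Metric.closedBall x (ρ / (k + 1)) := fun k => by
    rw [← (bump k).tsupport_eq]
    refine congrArg closure ?_
    ext y
    simp [χ]
  have hχ : ∀ k, IsTestFunction X (χ k) := fun k =>
    ⟨Complex.ofRealCLM.contDiff.comp (bump k).contDiff,
      (bump k).hasCompactSupport.comp_left Complex.ofReal_zero, by
      rw [hχsupp]
      refine (Metric.closedBall_subset_closedBall ?_).trans hball
      exact div_le_self hρ.le (by linarith [Nat.cast_nonneg (α := ℝ) k])⟩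
  -- Here `k` fixes both cutoff and cone, `N` is the order of decay, and `η` runs over the cone;
  -- rapid decay becomes boundedness of integrals against these weights.
  let w : ∀ k N : ℕ, coneBall ξ (1 / (k + 1) : ℝ) → W → ℂ := fun k N η y =>
    ((‖(η : ImagDual W)‖ ^ N : ℝ) : ℂ) *
      Complex.exp (-(((η : ImagDual W) : W →L[ℝ] ℂ) y)) * χ k y
  have hw : ∀ k N η, IsWeight X (w k N η) := fun k N η =>
    (hχ k).isWeight.mul_continuous (continuous_const.mul (continuous_exp_neg_imagDual _))
  have hwint : ∀ k N η (F : W → ℂ), ‖∫ y, w k N η y * F y‖ =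
      ‖(η : ImagDual W)‖ ^ N * ‖charInt (fun y => χ k y * F y) η‖ := fun k N η F => by
    have : ‖(η : ImagDual W)‖ ^ N = ‖((‖(η : ImagDual W)‖ ^ N : ℝ) : ℂ)‖ := by
      rw [Complex.norm_real, Real.norm_of_nonneg (by positivity)]
    rw [this, ← norm_mul, charInt, ← integral_const_mul]
    congr 2 with y
    simp only [w]
    ring
  obtain ⟨k, hk⟩ := exists_bound_of_hasSum (μ := volume) hX hP hP1 w hw
    (fun a b => by
      obtain ⟨k, hk⟩ := exists_charInt_decay_of_notMem hX (continuousOn_const.inner (hP a)) hρ hχ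
        (fun k => (hχsupp k).subset) (hcon a b)
      refine ⟨k, fun N => ?_⟩
      obtain ⟨A, hA⟩ := hk N
      exact ⟨A, fun η => (hwint k N η _).trans_le (hA η η.2)⟩) huv hf
  refine ⟨coneBall ξ (1 / (k + 1) : ℝ), isOpen_coneBall _ _, smul_mem_coneBall _ _,
    mem_coneBall_self (by positivity), χ k, hχ k, ?_, ?_⟩
  · simp only [χ]
    rw [(bump k).one_of_mem_closedBall (Metric.mem_closedBall_self (bump k).rIn_pos.le)]
    simp
  · rw [rapidlyDecaying_imagFourier_iff]
    intro N
    obtain ⟨M, hM⟩ := hk N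
    exact ⟨M, fun η hη => (hwint k N ⟨η, hη⟩ f).symm.trans_le (hM ⟨η, hη⟩)⟩

/-- Singular spectra of absolutely convergent sums of coefficients `⟨v, P(y) u⟩`. -/
theorem exists_mem_singularFiber_of_hasSum {X : Set W} {x : W} {P : W → V →L[ℂ] V}
    (hX : IsOpen X) (hP : ∀ u, ContinuousOn (fun y => P y u) X) (hP1 : ∀ y, ‖P y‖ ≤ 1)
    {κ : Type*} [Countable κ] {u v : κ → V} (huv : Summable fun j => ‖u j‖ * ‖v j‖) {f : W → ℂ}
    (hf : ∀ y, HasSum (fun j => inner ℂ (v j) (P y (u j))) (f y)) {ξ : ImagDual W}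
    (hξ : ξ ∈ singularFiber X f x) :
    ∃ a b : V, ξ ∈ singularFiber X (fun y => inner ℂ b (P y a)) x := by
  rcases hξ with rfl | hξ
  · exact ⟨0, 0, Or.inl rfl⟩
  by_contra! hcon
  refine hξ fun φ hφ hφa hφ0 => ?_
  -- The number `1 / (k + 1)` is both the radius of the neighbourhood and the rate of exponential
  -- decay, which the factor `exp (t / (k + 1))` turns into boundedness. A single condition suffices
  -- for each `k`, so the second index is a dummy.
  let w : ∀ k _ : ℕ, {t : ℝ // 0 < t} × Metric.ball ξ (1 / (k + 1) : ℝ) → W → ℂ :=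
    fun k _ p y => ((Real.exp (1 / (k + 1) * p.1) *
      ((2 * Real.pi) ^ Module.finrank ℝ W)⁻¹ : ℝ) : ℂ) *
      (Complex.exp (-((((p.1 : ℝ) • (p.2 : ImagDual W) : ImagDual W) : W →L[ℝ] ℂ) y)) *
        (gauss p.1 ‖x - y‖ : ℂ)) * φ y
  have hw : ∀ k N p, IsWeight X (w k N p) := fun k N p =>
    hφ.isWeight.mul_continuous (continuous_const.mul
      ((continuous_exp_neg_imagDual _).mul (Complex.continuous_ofReal.comp (by
        unfold gauss
        fun_prop))))
  have hwint : ∀ k N p (F : W → ℂ), ‖∫ y, w k N p y * F y‖ = Real.exp (1 / (k + 1) * p.1) *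
      ‖imagFourier (fun y => (gauss p.1 ‖x - y‖ : ℂ) * φ y * F y)
        ((p.1 : ℝ) • (p.2 : ImagDual W))‖ := fun k N p F => by
    have : Real.exp (1 / (k + 1) * p.1) * ((2 * Real.pi) ^ Module.finrank ℝ W)⁻¹ =
        ‖((Real.exp (1 / (k + 1) * p.1) * ((2 * Real.pi) ^ Module.finrank ℝ W)⁻¹ : ℝ) : ℂ)‖ := by
      rw [Complex.norm_real, Real.norm_of_nonneg (by positivity)]
    rw [norm_imagFourier, ← mul_assoc, this, ← norm_mul, charInt, ← integral_const_mul]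
    congr 2 with y
    simp only [w]
    ring
  obtain ⟨k, hk⟩ := exists_bound_of_hasSum (μ := volume) hX hP hP1 w hw
    (fun a b => by
      have hab := hcon a b
      simp only [singularFiber, Set.mem_ofPred_eq, not_or, not_not] at hab
      obtain ⟨Ω, hΩ, hξΩ, ε, hε, A, hA, hdec⟩ := hab.2 φ hφ hφa hφ0
      obtain ⟨R, hR, hball⟩ := Metric.isOpen_iff.1 hΩ ξ hξΩ
      obtain ⟨k, hk⟩ := exists_nat_one_div_lt (lt_min hR hε)
      refine ⟨k, fun _ => ⟨A, fun p => ?_⟩⟩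
      have h1 := hdec p.1 p.1.2 p.2
        (hball (Metric.ball_subset_ball (hk.trans_le (min_le_left _ _)).le p.2.2))
      rw [hwint k 0]
      calc _ ≤ Real.exp (1 / (k + 1) * p.1) * (A * Real.exp (-(ε * p.1))) := by gcongr
        _ ≤ Real.exp (ε * p.1) * (A * Real.exp (-(ε * p.1))) := by
          gcongr
          · exact p.1.2.le
          · exact (hk.trans_le (min_le_right _ _)).le
        _ = A := by
          rw [mul_left_comm, ← Real.exp_add, add_neg_cancel, Real.exp_zero, mul_one]) huv hf
  obtain ⟨M, hM⟩ := hk 0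
  refine ⟨Metric.ball ξ (1 / (k + 1) : ℝ), Metric.isOpen_ball,
    Metric.mem_ball_self (by positivity), 1 / (k + 1), by positivity, max M 1, by positivity,
    fun t ht η hη => ?_⟩
  have h1 := (hwint k 0 (⟨t, ht⟩, ⟨η, hη⟩) f).symm.trans_le (hM _)
  rw [Real.exp_neg, ← div_eq_mul_inv, le_div_iff₀ (Real.exp_pos _), mul_comm]
  exact h1.trans (le_max_left _ _)

omit [MeasurableSpace W] [BorelSpace W] [FiniteDimensional ℝ W] in
theorem norm_mulI (η : W →L[ℝ] ℝ) : ‖mulI η‖ = ‖η‖ := by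
  have h : ∀ y, ‖(mulI η : W →L[ℝ] ℂ) y‖ = ‖η y‖ := fun y => by
    simp [mulI]
  change ‖(mulI η : W →L[ℝ] ℂ)‖ = _
  refine le_antisymm ?_ ?_
  · refine ContinuousLinearMap.opNorm_le_bound _ (norm_nonneg _) fun y => ?_
    rw [h]
    exact η.le_opNorm y
  · refine ContinuousLinearMap.opNorm_le_bound _ (norm_nonneg _) fun y => ?_
    rw [← h]
    exact (mulI η : W →L[ℝ] ℂ).le_opNorm y

end Fourier

/-! ### Real and imaginary covectors -/

section MulI

variable (W : Type*) [AddCommGroup W] [Module ℝ W] [TopologicalSpace W]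
  [IsTopologicalAddGroup W] [ContinuousSMul ℝ W]

/-- Multiplication by `i` as a linear homeomorphism from `W*` onto `iW*`. -/
noncomputable def mulIEquiv : (W →L[ℝ] ℝ) ≃L[ℝ] ImagDual W where
  toFun := mulI
  invFun ξ := Complex.imCLM ∘L (ξ : W →L[ℝ] ℂ)
  map_add' a b := by
    ext w
    simp [mulI]
  map_smul' c a := by
    ext w
    simp [mulI, mul_left_comm]
  left_inv a := by
    ext w
    simp [mulI]
  right_inv ξ := by
    ext w
    apply Complex.ext
    · simpa [mulI] using (ξ.2 w).symm
    · simp [mulI]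
  continuous_toFun := Continuous.subtype_mk
    ((((Complex.I • Complex.ofRealCLM : ℝ →L[ℝ] ℂ)).postcomp W).continuous) _
  continuous_invFun := (Complex.imCLM.postcomp W).continuous.comp continuous_subtype_val

end MulI

section RealWavefront

variable {W : Type*} [NormedAddCommGroup W] [InnerProductSpace ℝ W]
  [MeasurableSpace W] [BorelSpace W] [FiniteDimensional ℝ W]

theorem charInt_mulI (g : W → ℂ) (η : W →L[ℝ] ℝ) :
    charInt g (mulI η) = ∫ y, g y * Complex.exp (-(Complex.I * (η y : ℂ))) := rfl

/-- Multiplication by `i` is a norm preserving linear homeomorphism, so open cones correspond, and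
the two integrals differ only by the factor `(2π)^{-n}`, irrelevant to decay. -/
theorem mem_realWavefrontFiber_iff {X : Set W} {f : W → ℂ} {x : W} {η : W →L[ℝ] ℝ} :
    η ∈ realWavefrontFiber X f x ↔ mulI η ∈ wavefrontFiber X f x := by
  have hmulI : ∀ ζ, mulIEquiv W ζ = mulI ζ := fun ζ => rfl
  refine or_congr ?_ (not_congr ⟨?_, ?_⟩)
  · rw [← hmulI, map_eq_zero_iff _ (mulIEquiv W).injective]
  · rintro ⟨C, hC, hcone, hη, φ, hφ, hφ0, hdec⟩
    refine ⟨(mulIEquiv W).symm ⁻¹' C, hC.preimage (mulIEquiv W).symm.continuous, ?_, ?_, φ, hφ, hφ0,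
      ?_⟩
    · intro ζ hζ t ht
      rw [Set.mem_preimage, map_smul]
      exact hcone _ hζ t ht
    · rwa [Set.mem_preimage, ← hmulI, ContinuousLinearEquiv.symm_apply_apply]
    · rw [rapidlyDecaying_imagFourier_iff]
      intro N
      obtain ⟨A, -, hA⟩ := hdec N
      refine ⟨A, fun ζ hζ => ?_⟩
      obtain ⟨ζ, rfl⟩ := (mulIEquiv W).surjective ζ
      rw [Set.mem_preimage, ContinuousLinearEquiv.symm_apply_apply] at hζ
      rw [hmulI, norm_mulI, charInt_mulI]
      exact hA ζ hζ
  · rintro ⟨C, hC, hcone, hη, φ, hφ, hφ0, hdec⟩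
    refine ⟨mulIEquiv W ⁻¹' C, hC.preimage (mulIEquiv W).continuous, ?_, hη, φ, hφ, hφ0,
      fun N => ?_⟩
    · intro ζ hζ t ht
      rw [Set.mem_preimage, map_smul]
      exact hcone _ hζ t ht
    · obtain ⟨A, hA⟩ := rapidlyDecaying_imagFourier_iff.1 hdec N
      refine ⟨max A 1, by positivity, fun ζ hζ => ?_⟩
      have := hA _ hζ
      rw [hmulI, norm_mulI, charInt_mulI] at this
      exact this.trans (le_max_left _ _)

end RealWavefront

/-! ### Coefficients of unitary representations -/

section Unitary

variable {n : ℕ} {G : Type*} [TopologicalSpace G]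
  [ChartedSpace (EuclideanSpace ℝ (Fin n)) G] [Group G]
  {V : Type*} [NormedAddCommGroup V] [InnerProductSpace ℂ V] [CompleteSpace V]
  (π : G →* unitary (V →L[ℂ] V))

theorem norm_coe_unitary_le_one (U : unitary (V →L[ℂ] V)) : ‖(U : V →L[ℂ] V)‖ ≤ 1 := by
  refine ContinuousLinearMap.opNorm_le_bound _ zero_le_one fun x => ?_
  rw [one_mul, ContinuousLinearMap.norm_map_of_mem_unitary U.2]

theorem continuousOn_unitary_chart_symm
    (hπ : ∀ v : V, Continuous fun g : G => (π g : V →L[ℂ] V) v) (g : G) (u : V) :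
    ContinuousOn (fun y => (π ((extChartAt (𝓡 n) g).symm y) : V →L[ℂ] V) u)
      (extChartAt (𝓡 n) g).target :=
  (hπ u).comp_continuousOn (continuousOn_extChartAt_symm g)

omit [TopologicalSpace G] in
theorem matrixCoeff_eq_traceCoeff (u v : V) :
    matrixCoeff π u v = traceCoeff π (InnerProductSpace.rankOne ℂ u v) :=
  funext fun g => (trace_comp_rankOne (π g : V →L[ℂ] V) u v).symm

/-- Matrix coefficients and trace class coefficients have the same wave front sets, even before
taking closures. -/
theorem iUnion_WFAt_matrixCoeff (hπ : ∀ v : V, Continuous fun g : G => (π g : V →L[ℂ] V) v) :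
    ⋃ (u : V) (v : V), WFAt (n := n) (matrixCoeff π u v) 1 =
      ⋃ (T : V →L[ℂ] V) (_ : IsTraceClass T), WFAt (n := n) (traceCoeff π T) 1 := by
  refine Set.Subset.antisymm (Set.iUnion₂_subset fun u v => ?_) (Set.iUnion₂_subset fun T hT => ?_)
  · rw [matrixCoeff_eq_traceCoeff]
    exact Set.subset_iUnion₂_of_subset _ (isTraceClass_rankOne u v) subset_rfl
  · rintro ξ ⟨η, hη, hξ⟩
    obtain ⟨s, _, u, v, huv, hsum⟩ := hT.exists_hasSum_trace
    obtain ⟨a, b, hab⟩ := exists_mem_wavefrontFiber_of_hasSum (mem_extChartAt_target 1)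
      (isOpen_extChartAt_target (1 : G)) (continuousOn_unitary_chart_symm π hπ 1)
      (fun y => norm_coe_unitary_le_one _) huv (fun y => hsum _) hη
    exact Set.mem_iUnion₂.2 ⟨a, b, η, hab, hξ⟩

/-- Matrix coefficients and trace class coefficients have the same singular spectra, even before
taking closures. -/
theorem iUnion_SSAt_matrixCoeff (hπ : ∀ v : V, Continuous fun g : G => (π g : V →L[ℂ] V) v) :
    ⋃ (u : V) (v : V), SSAt (n := n) (matrixCoeff π u v) 1 =
      ⋃ (T : V →L[ℂ] V) (_ : IsTraceClass T), SSAt (n := n) (traceCoeff π T) 1 := by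
  refine Set.Subset.antisymm (Set.iUnion₂_subset fun u v => ?_) (Set.iUnion₂_subset fun T hT => ?_)
  · rw [matrixCoeff_eq_traceCoeff]
    exact Set.subset_iUnion₂_of_subset _ (isTraceClass_rankOne u v) subset_rfl
  · rintro ξ ⟨η, hη, hξ⟩
    obtain ⟨s, _, u, v, huv, hsum⟩ := hT.exists_hasSum_trace
    obtain ⟨a, b, hab⟩ := exists_mem_singularFiber_of_hasSum
      (isOpen_extChartAt_target (1 : G)) (continuousOn_unitary_chart_symm π hπ 1)
      (fun y => norm_coe_unitary_le_one _) huv (fun y => hsum _) hη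
    exact Set.mem_iUnion₂.2 ⟨a, b, η, hab, hξ⟩

theorem image_mulI_realWFAt {M : Type*} [TopologicalSpace M]
    [ChartedSpace (EuclideanSpace ℝ (Fin n)) M] (f : M → ℂ) (x : M) :
    mulI '' realWFAt (n := n) f x = WFAt f x := by
  ext ξ
  constructor
  · rintro ⟨ζ, ⟨η, hη, hζ⟩, rfl⟩
    refine ⟨mulI η, mem_realWavefrontFiber_iff.1 hη, fun v => ?_⟩
    change Complex.I * ((ζ v : ℝ) : ℂ) = Complex.I * ((η _ : ℝ) : ℂ)
    rw [hζ]
  · rintro ⟨η, hη, hξ⟩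
    obtain ⟨η, rfl⟩ := (mulIEquiv _).surjective η
    obtain ⟨ζ, rfl⟩ := (mulIEquiv _).surjective ξ
    refine ⟨ζ, ⟨η, mem_realWavefrontFiber_iff.2 hη, fun v => ?_⟩, rfl⟩
    have h : Complex.I * ((ζ v : ℝ) : ℂ) = Complex.I * ((η _ : ℝ) : ℂ) := hξ v
    exact_mod_cast mul_left_cancel₀ Complex.I_ne_zero h

/-- The closure commutes with `mulI` because it is a homeomorphism; before closure the sets
correspond for each `T`. -/
theorem image_mulI_howeWF : mulI '' howeWF n π = traceWF n π := by
  have h := (mulIEquiv (GroupLieAlgebra (𝓡 n) G)).toHomeomorph.image_closure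
    (⋃ (T : V →L[ℂ] V) (_ : IsTraceClass T), realWFAt (n := n) (traceCoeff π T) 1)
  refine h.trans ?_
  rw [Set.image_iUnion₂]
  exact congrArg closure (Set.iUnion₂_congr fun T _ => image_mulI_realWFAt _ _)

end Unitary

end RepWF

theorem mainTheorem6 {n : ℕ} {G : Type*} [TopologicalSpace G]
    [ChartedSpace (EuclideanSpace ℝ (Fin n)) G] [Group G] [LieGroup (𝓡 n) ω G]
    {V : Type*} [NormedAddCommGroup V] [InnerProductSpace ℂ V] [CompleteSpace V]
    (π : G →* unitary (V →L[ℂ] V))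
    (hπ : ∀ v : V, Continuous fun g : G => (π g : V →L[ℂ] V) v) :
    RepWF.WF n π = RepWF.traceWF n π ∧
      RepWF.SS n π = RepWF.traceSS n π ∧
      RepWF.WF n π = RepWF.mulI '' RepWF.howeWF n π := by
  have h := congrArg closure (RepWF.iUnion_WFAt_matrixCoeff (n := n) π hπ)
  exact ⟨h, congrArg closure (RepWF.iUnion_SSAt_matrixCoeff (n := n) π hπ),
    h.trans (RepWF.image_mulI_howeWF π).symm⟩
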